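/- Datasets are finite multisets over a universe $\mathcal X$; two datasets are adjacent if one arises from the other by adding or removing one element. Messages come from countable sets. An interactive mechanism $\mathcal M$ maps (dataset, list of all queries received so far, random coins) to its next message, which is an answer or $\mathtt{halt}$; an adversary $\mathcal A$ (computationally unbounded) maps (list of all answers received so far, random coins) to its next message, a query or $\mathtt{halt}$; $\mathcal A$ moves first, they alternate, and the interaction ends once $\mathtt{halt}$ is sent. The view of $\mathcal A$ consists of its coins and of the (finite or infinite) sequence of messages it receives. $\mathcal M$ is $(\varepsilon,\delta)$-DP if $\Pr[\mathrm{View}\langle\mathcal A,\mathcal M(x)\rangle\in T]\le e^{\varepsilon}\Pr[\mathrm{View}\langle\mathcal A,\mathcal M(x')\rangle\in T]+\delta$ for all adjacent $x,x'$, all $\mathcal A$ and all measurable $T$, with independent coins of both parties. $\mathrm{ConComp}(\mathcal M_0,\dots,\mathcal M_{k-1})$ runs all $\mathcal M_j$ on the same dataset with independent coins; a query is a pair $(q,j)$ with $0\le j<k$, and it is answered by $\mathcal M_j$ on the list of all queries addressed to $\mathcal M_j$ so far. A noninteractive mechanism $\mathcal M$ with values in $\mathcal Y$ is $(\varepsilon,\delta)$-DP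 if $\Pr[\mathcal M(x)\in T]\le e^{\varepsilon}\Pr[\mathcal M(x')\in T]+\delta$ for all adjacent inputs $x,x'$ and all measurable $T\subseteq\mathcal Y$; $\mathrm{Comp}$ denotes independent runs on the same input. For $\varepsilon\ge0$, $\mathrm{RR}_\varepsilon:\{0,1\}\to\{0,1\}$ outputs its input $b$ with probability $\frac{e^\varepsilon}{1+e^\varepsilon}$ and $\neg b$ with probability $\frac1{1+e^\varepsilon}$; its two inputs are adjacent. For an interactive or noninteractive mechanism, $\mathrm{PrivLoss}(\mathcal M,\delta)=\inf\{\varepsilon\ge0:\mathcal M\text{ is }(\varepsilon,\delta)\text{-DP}\}$. Let $k\ge0$, $\varepsilon_0,\dots,\varepsilon_{k-1}\ge0$ and $\delta_g\ge0$. 1. If interactive mechanisms $\mathcal M_i$ are $(\varepsilon_i,0)$-DP for all $i$, then for every $\varepsilon_g\ge0$ such that $\mathrm{Comp}(\mathrm{RR}_{\varepsilon_0},\dots,\mathrm{RR}_{\varepsilon_{k-1}})$ is $(\varepsilon_g,\delta_g)$-DP, $\mathrm{ConComp}(\mathcal M_0,\dots,\mathcal M_{k-1})$ is $(\varepsilon_g,\delta_g)$-DP.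 Hence $\mathrm{PrivLoss}(\mathrm{ConComp}(\mathcal M_0,\dots,\mathcal M_{k-1}),\delta_g)\le\mathrm{PrivLoss}(\mathrm{Comp}(\mathrm{RR}_{\varepsilon_0},\dots,\mathrm{RR}_{\varepsilon_{k-1}}),\delta_g)$. 2. If $\mathcal X$ is nonempty, there is at least one query and there are at least two answers, then $$\max_{\mathcal M_0,\dots,\mathcal M_{k-1}}\mathrm{PrivLoss}(\mathrm{ConComp}(\mathcal M_0,\dots,\mathcal M_{k-1}),\delta_g)=\mathrm{PrivLoss}(\mathrm{Comp}(\mathrm{RR}_{\varepsilon_0},\dots,\mathrm{RR}_{\varepsilon_{k-1}}),\delta_g),$$ where the maximum, which is attained, is over all tuples of interactive mechanisms such that $\mathcal M_i$ is $(\varepsilon_i,0)$-DP for all $i$. 3. (Optimal composition.) There is a least $\varepsilon_g\ge0$ such that $$\frac1{\prod_{i=0}^{k-1}(1+e^{\varepsilon_i})}\sum_{S\subseteq\{0,\dots,k-1\}}\max\Bigl\{e^{\sum_{i\in S}\varepsilon_i}-e^{\varepsilon_g}e^{\sum_{i\notin S}\varepsilon_i},0\Bigr\}\le\delta_g.$$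 It equals $\mathrm{PrivLoss}(\mathrm{Comp}(\mathrm{RR}_{\varepsilon_0},\dots,\mathrm{RR}_{\varepsilon_{k-1}}),\delta_g)$, and $\mathrm{ConComp}(\mathcal M_0,\dots,\mathcal M_{k-1})$ is $(\varepsilon_g,\delta_g)$-DP for all $(\varepsilon_i,0)$-DP interactive mechanisms $\mathcal M_i$. If $\varepsilon_0=\dots=\varepsilon_{k-1}=\varepsilon$, the same holds for the least $\varepsilon_g\ge0$ such that $$\frac1{(1+e^{\varepsilon})^k}\sum_{i=0}^k\binom ki\max\bigl\{e^{i\varepsilon}-e^{\varepsilon_g}e^{(k-i)\varepsilon},0\bigr\}\le\delta_g.$$ 4. (Advanced composition.) There is a universal constant $C>0$ such that for all $\varepsilon\ge0$, all $k$ with $k\varepsilon^2<1$ and all $\delta'\in(0,1/2)$: if $\mathcal M_0,\dots,\mathcal M_{k-1}$ are $(\varepsilon,0)$-DP interactive mechanisms, then $\mathrm{ConComp}(\mathcal M_0,\dots,\mathcal M_{k-1})$ is $\bigl(C\sqrt{k\log(1/\delta')}\,\varepsilon,\ \delta'\bigr)$-DP. -/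

import Mathlib

open MeasureTheory
open scoped ENNReal NNReal

universe u v w

namespace ConcurrentDP

noncomputable section

/-- Two datasets, multisets over the universe `X`, are adjacent if one is obtained from the
other by adding or removing a single element. -/
def DatasetAdj {X : Type u} (x x' : Multiset X) : Prop :=
  ∃ a : X, x' = a ::ₘ x ∨ x = a ::ₘ x'

/-! ### Interactive protocols -/

/-- An interactive mechanism with private input in `D`, receiving queries in `Q` and sending
answers in `A`. Its random coins are an arbitrary probability space. `respond x h r` is the next
message it sends, when `h` is the list of all queries received so far (oldest first, the query to
be answered last) and `r` are its coins; the message `none` is `halt`. -/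
structure InteractiveMechanism (D : Type u) (Q : Type v) (A : Type w) where
  Coins : Type
  [instMeasurableSpace : MeasurableSpace Coins]
  coinLaw : Measure Coins
  [instProb : IsProbabilityMeasure coinLaw]
  respond : D → List Q → Coins → Option A
  measurableSet_respond : ∀ x h a, MeasurableSet {r | respond x h r = a}

attribute [instance] InteractiveMechanism.instMeasurableSpace InteractiveMechanism.instProb

/-- An adversary: a computationally unbounded party without private input. `ask h r` is its next
message, when `h` is the list of all answers received so far (oldest first) and `r` are its coins;
the message `none` is `halt` (or a message that is not a well-formed query). -/
structure Adversary (Q : Type v) (A : Type w) where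
  Coins : Type
  [instMeasurableSpace : MeasurableSpace Coins]
  coinLaw : Measure Coins
  [instProb : IsProbabilityMeasure coinLaw]
  ask : List A → Coins → Option Q
  measurableSet_ask : ∀ h q, MeasurableSet {r | ask h r = q}

attribute [instance] Adversary.instMeasurableSpace Adversary.instProb

variable {D : Type u} {Q : Type v} {A : Type w}

/-- The list of the first `n` (query, answer) pairs of the interaction of `𝒜` with coins `rA` and
`M` with input `x` and coins `rM`; `none` if one of them has sent `halt` before that. -/
def transcript (𝒜 : Adversary Q A) (M : InteractiveMechanism D Q A) (x : D)
    (rA : 𝒜.Coins) (rM : M.Coins) : ℕ → Option (List (Q × A))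
  | 0 => some []
  | n + 1 =>
    (transcript 𝒜 M x rA rM n).bind fun h =>
      (𝒜.ask (h.map Prod.snd) rA).bind fun q =>
        (M.respond x (h.map Prod.fst ++ [q]) rM).map fun a => h ++ [(q, a)]

/-- The view of `𝒜`: its coins and the sequence of the answers it receives. The `n`-th entry of
the sequence is `none` if that message is `halt` or the interaction is already over (which of the
two is determined by the rest of the view). -/
def view (𝒜 : Adversary Q A) (M : InteractiveMechanism D Q A) (x : D)
    (rA : 𝒜.Coins) (rM : M.Coins) : 𝒜.Coins × (ℕ → Option A) :=
  (rA, fun n => (transcript 𝒜 M x rA rM (n + 1)).bind fun h => (h.map Prod.snd).getLast?)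

/-- The σ-algebra on the space of views: the product of that of the coins of `𝒜` and of the
discrete σ-algebras on the single messages. -/
abbrev viewMeasurableSpace (𝒜 : Adversary Q A) : MeasurableSpace (𝒜.Coins × (ℕ → Option A)) :=
  @Prod.instMeasurableSpace _ _ _ (@MeasurableSpace.pi ℕ (fun _ => Option A) (fun _ => ⊤))

/-- The probability, over independent coins of both parties, that the view of `𝒜` is in `T`. -/
def probView (𝒜 : Adversary Q A) (M : InteractiveMechanism D Q A) (x : D)
    (T : Set (𝒜.Coins × (ℕ → Option A))) : ℝ≥0∞ :=
  (𝒜.coinLaw.prod M.coinLaw) {r | view 𝒜 M x r.1 r.2 ∈ T}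

/-- `M` is an `(ε, δ)`-differentially private interactive mechanism, with respect to the adjacency
relation `adj` on its inputs. -/
def InteractiveMechanism.IsDP (adj : D → D → Prop) (M : InteractiveMechanism D Q A)
    (ε δ : ℝ) : Prop :=
  ∀ x x', adj x x' → ∀ (𝒜 : Adversary Q A) (T : Set (𝒜.Coins × (ℕ → Option A))),
    MeasurableSet[viewMeasurableSpace 𝒜] T →
      probView 𝒜 M x T ≤ ENNReal.ofReal (Real.exp ε) * probView 𝒜 M x' T + ENNReal.ofReal δ

/-- The privacy loss of `M` at `δ`: the infimum of all `ε ≥ 0` such that `M` is `(ε, δ)`-DP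
(`∞` if there is none). -/
def InteractiveMechanism.privLoss (adj : D → D → Prop) (M : InteractiveMechanism D Q A)
    (δ : ℝ) : ℝ≥0∞ :=
  ⨅ (ε : ℝ≥0) (_ : M.IsDP adj ε δ), (ε : ℝ≥0∞)

/-- The concurrent composition of `M 0, …, M (k - 1)`, all run on the same dataset with
independent coins. A query is a pair `(q, j)`; it is answered by `M j`, which is given all queries
addressed to `M j` so far. -/
def conComp {k : ℕ} (M : Fin k → InteractiveMechanism D Q A) :
    InteractiveMechanism D (Q × Fin k) A where
  Coins := ∀ j, (M j).Coins
  coinLaw := Measure.pi fun j => (M j).coinLaw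
  respond x h r :=
    h.getLast?.bind fun m =>
      (M m.2).respond x ((h.filter fun m' => m'.2 = m.2).map Prod.fst) (r m.2)
  measurableSet_respond x h a := by
    cases h.getLast? with
    | none => simp
    | some m =>
      exact ((M m.2).measurableSet_respond x
        ((h.filter fun m' => m'.2 = m.2).map Prod.fst) a).preimage
        (measurable_pi_apply (X := fun j => (M j).Coins) m.2)

/-! ### Noninteractive mechanisms

A noninteractive mechanism assigns to each input the law of its output. -/

/-- `(ε, δ)`-differential privacy of a noninteractive mechanism. -/
def IsDP {Y : Type v} [MeasurableSpace Y] (adj : D → D → Prop) (M : D → Measure Y)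
    (ε δ : ℝ) : Prop :=
  ∀ x x', adj x x' → ∀ T : Set Y, MeasurableSet T →
    M x T ≤ ENNReal.ofReal (Real.exp ε) * M x' T + ENNReal.ofReal δ

/-- The privacy loss of a noninteractive mechanism at `δ`. -/
def privLoss {Y : Type v} [MeasurableSpace Y] (adj : D → D → Prop) (M : D → Measure Y)
    (δ : ℝ) : ℝ≥0∞ :=
  ⨅ (ε : ℝ≥0) (_ : IsDP adj M ε δ), (ε : ℝ≥0∞)

/-- Composition of noninteractive mechanisms: independent runs on the same input. -/
def comp {k : ℕ} {Y : Type v} [MeasurableSpace Y] (M : Fin k → D → Measure Y) :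
    D → Measure (Fin k → Y) :=
  fun x => Measure.pi fun i => M i x

/-- Randomized response on a bit: the input bit with probability `e^ε / (1 + e^ε)`, its negation
with probability `1 / (1 + e^ε)`. -/
def RR (ε : ℝ) : Bool → Measure Bool := fun b =>
  ENNReal.ofReal (Real.exp ε / (1 + Real.exp ε)) • Measure.dirac b +
    ENNReal.ofReal (1 / (1 + Real.exp ε)) • Measure.dirac (!b)

instance (ε : ℝ) (b : Bool) : IsProbabilityMeasure (RR ε b) := by
  constructor
  have h : 0 < 1 + Real.exp ε := by positivity
  simp only [RR, Measure.add_apply, Measure.smul_apply, measure_univ, smul_eq_mul, mul_one]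
  rw [← ENNReal.ofReal_add (by positivity) (by positivity), ← ENNReal.ofReal_one]
  congr 1
  field_simp
  ring

/-- Any two distinct bits are adjacent inputs. -/
def BitAdj (b b' : Bool) : Prop := b ≠ b'

end

end ConcurrentDP

open ConcurrentDP

/-!
A pure DP mechanism behaves, on two adjacent inputs, like an interactive post-processing of
randomized response. If `p c` denotes the probability that it answers certain queries in a certain
way on the input with index `c : Bool`, then `p c ≤ e^ε p (!c)` says exactly that the coordinates
`∑ c, rrInv ε b c * p c` of `p` with respect to the matrix of randomized response are nonnegative
(`sum_rrInv_mul_nonneg`).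

For fixed coins of the adversary, the probability that the concurrent composition produces given
initial messages is a product of such probabilities, one for each mechanism
(`view_prefix_iff_outcome`, `outcome_conComp`); this is where concurrency becomes harmless, since the
order in which queries to different mechanisms are interleaved does not affect the factors. Letting
each mechanism run on either of the two datasets gives `2 ^ k` laws of the view, whose combinations
`ν b` with coefficients `∏ j, rrInv (ε j) (b j) (c j)` have total mass `1` and are nonnegative on
initial messages by factorization, hence everywhere (`sum_mul_measureReal_nonneg`). So the view
on either dataset is the mixture of the laws `ν b`, where `b` is the output of composed randomized
response, and inherits its guarantees (`measureReal_le_hockeyStick`). The matrix is singular for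
`ε = 0`; that case follows by a limit.

The guarantees of composed randomized response are explicit: it is `(g, δ)`-DP iff the hockey-stick
divergence, a finite sum, is at most `δ` (`isDP_comp_RR_iff`). As a continuous function of `g` that
vanishes at `g = ∑ i, ε i`, it gives a least `g`, and a Chernoff bound for it gives advanced
composition. Conversely, randomized response of the bit that tells whether the dataset is empty is
a pure DP interactive mechanism, and an adversary that queries `k` of these once each sees the
output of composed randomized response, so the bound is attained.
-/

namespace ConcurrentDP

noncomputable section

/-! ### Randomized response and its privacy curve -/

/-- For finite measures, the `(g, δ)`-DP inequality can be checked in `ℝ`. -/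
lemma measure_le_iff_real {Ω Ω' : Type*} [MeasurableSpace Ω] [MeasurableSpace Ω']
    (μ : Measure Ω) (ν : Measure Ω') [IsFiniteMeasure μ] [IsFiniteMeasure ν] (S : Set Ω) (T : Set Ω')
    (g : ℝ) {δ : ℝ} (hδ : 0 ≤ δ) :
    μ S ≤ ENNReal.ofReal (Real.exp g) * ν T + ENNReal.ofReal δ ↔
      μ.real S ≤ Real.exp g * ν.real T + δ := by
  rw [← ofReal_measureReal (μ := μ) (s := S), ← ofReal_measureReal (μ := ν) (s := T),
    ← ENNReal.ofReal_mul (by positivity), ← ENNReal.ofReal_add (by positivity) hδ,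
    ENNReal.ofReal_le_ofReal_iff (by positivity)]

/-- The probability that randomized response on input `c` outputs `b`. -/
def rrWeight (ε : ℝ) (c b : Bool) : ℝ :=
  (if b = c then Real.exp ε else 1) / (1 + Real.exp ε)

lemma rrWeight_le (ε : ℝ) (hε : 0 ≤ ε) (c c' b : Bool) :
    rrWeight ε c b ≤ Real.exp ε * rrWeight ε c' b := by
  have h : 1 ≤ Real.exp ε := Real.one_le_exp hε
  unfold rrWeight
  rw [← mul_div_assoc]
  gcongr
  split_ifs <;> nlinarith

lemma RR_real_singleton (ε : ℝ) (c b : Bool) : (RR ε c).real {b} = rrWeight ε c b := by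
  have h : 0 ≤ Real.exp ε / (1 + Real.exp ε) := by positivity
  have h' : 0 ≤ (1 + Real.exp ε)⁻¹ := by positivity
  cases c <;> cases b <;> simp [RR, rrWeight, Measure.real, h, h']

lemma comp_RR_real {k : ℕ} (ε : Fin k → ℝ) (c : Bool) (T : Finset (Fin k → Bool)) :
    (comp (fun i => RR (ε i)) c).real T = ∑ b ∈ T, ∏ i, rrWeight (ε i) c (b i) := by
  have : IsProbabilityMeasure (comp (fun i => RR (ε i)) c) := by unfold comp; infer_instance
  rw [← sum_measureReal_singleton]
  refine Finset.sum_congr rfl fun b _ => ?_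
  simp only [comp, Measure.real, Measure.pi_singleton, ENNReal.toReal_prod]
  exact Finset.prod_congr rfl fun i _ => RR_real_singleton _ _ _

/-- The hockey-stick divergence of order `e ^ g` between the two output laws of
`Comp(RR_{ε 0}, …, RR_{ε (k - 1)})`; the set `S` consists of the truthful responses. -/
def hockeyStick {k : ℕ} (ε : Fin k → ℝ) (g : ℝ) : ℝ :=
  1 / (∏ i, (1 + Real.exp (ε i))) *
    ∑ S : Finset (Fin k),
      max (Real.exp (∑ i ∈ S, ε i) - Real.exp g * Real.exp (∑ i ∈ Sᶜ, ε i)) 0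

lemma prod_rrWeight {k : ℕ} (ε : Fin k → ℝ) (c : Bool) (b : Fin k → Bool) :
    ∏ i, rrWeight (ε i) c (b i) =
      1 / (∏ i, (1 + Real.exp (ε i))) * Real.exp (∑ i with b i = c, ε i) := by
  simp only [rrWeight, Finset.prod_div_distrib, Real.exp_sum, Finset.prod_filter]
  ring

lemma sum_max_rrWeight {k : ℕ} (ε : Fin k → ℝ) (g : ℝ) (c : Bool) :
    ∑ b : Fin k → Bool,
      max ((∏ i, rrWeight (ε i) c (b i)) - Real.exp g * ∏ i, rrWeight (ε i) (!c) (b i)) 0 =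
      hockeyStick ε g := by
  unfold hockeyStick
  rw [Finset.mul_sum]
  refine Finset.sum_bij' (fun b _ => ({i | b i = c} : Finset (Fin k)))
    (fun S _ i => if i ∈ S then c else !c) (by simp) (by simp) ?_ ?_ ?_
  · intro b _
    funext i
    cases h : b i <;> cases c <;> simp [h]
  · intro S _
    ext i
    by_cases h : i ∈ S <;> simp [h]
  · intro b _
    have h : ({i | b i = !c} : Finset (Fin k)) = ({i | b i = c} : Finset (Fin k))ᶜ := by
      ext i
      simp only [Finset.mem_filter, Finset.mem_univ, true_and, Finset.mem_compl]
      cases b i <;> cases c <;> simp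
    have h0 : (0 : ℝ) ≤ 1 / ∏ i, (1 + Real.exp (ε i)) :=
      one_div_nonneg.2 (Finset.prod_nonneg fun i _ => by positivity)
    rw [prod_rrWeight, prod_rrWeight, h, mul_max_of_nonneg _ _ h0, mul_zero]
    congr 1
    ring

lemma isDP_comp_RR_iff {k : ℕ} (ε : Fin k → ℝ) (g : ℝ) {δ : ℝ} (hδ : 0 ≤ δ) :
    IsDP BitAdj (comp fun i => RR (ε i)) g δ ↔ hockeyStick ε g ≤ δ := by
  classical
  have hp : ∀ c, IsProbabilityMeasure (comp (fun i => RR (ε i)) c) := fun c => by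
    unfold comp; infer_instance
  constructor
  · intro h
    -- The outputs that are more likely on input `true`, by a factor of at least `e ^ g`.
    let T : Finset (Fin k → Bool) :=
      {b | 0 ≤ (∏ i, rrWeight (ε i) true (b i)) - Real.exp g * ∏ i, rrWeight (ε i) false (b i)}
    have h1 := (measure_le_iff_real _ _ _ _ g hδ).1
      (h true false (by simp [BitAdj]) T (Set.toFinite _).measurableSet)
    rw [comp_RR_real, comp_RR_real, Finset.mul_sum, ← sub_le_iff_le_add',
      ← Finset.sum_sub_distrib, Finset.sum_filter] at h1
    rw [← sum_max_rrWeight ε g true]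
    refine le_trans (le_of_eq (Finset.sum_congr rfl fun b _ => ?_)) h1
    rw [max_comm, max_def]
    rfl
  · intro h c c' hc T _
    obtain rfl : c' = !c := by
      revert hc; cases c <;> cases c' <;> simp [BitAdj]
    rw [measure_le_iff_real _ _ _ _ g hδ, ← Set.coe_toFinset T, comp_RR_real, comp_RR_real,
      Finset.mul_sum, ← sub_le_iff_le_add', ← Finset.sum_sub_distrib]
    rw [← sum_max_rrWeight ε g c] at h
    refine le_trans ?_ h
    exact (Finset.sum_le_sum fun b _ => le_max_left _ _).trans
      (Finset.sum_le_sum_of_subset_of_nonneg (Finset.subset_univ _) fun b _ _ => le_max_right _ _)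

lemma continuous_hockeyStick {k : ℕ} :
    Continuous fun p : (Fin k → ℝ) × ℝ => hockeyStick p.1 p.2 := by
  unfold hockeyStick
  refine Continuous.mul (continuous_const.div (by fun_prop) fun p => ?_) (by fun_prop)
  exact (Finset.prod_pos fun i _ => by positivity).ne'

lemma hockeyStick_sum_eq_zero {k : ℕ} (ε : Fin k → ℝ) (hε : ∀ i, 0 ≤ ε i) :
    hockeyStick ε (∑ i, ε i) = 0 := by
  unfold hockeyStick
  rw [Finset.sum_eq_zero, mul_zero]
  intro S _
  rw [max_eq_right]
  rw [← Real.exp_add, sub_nonpos, Real.exp_le_exp]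
  have h1 : ∑ i ∈ S, ε i ≤ ∑ i, ε i :=
    Finset.sum_le_sum_of_subset_of_nonneg (Finset.subset_univ _) fun i _ _ => hε i
  have h2 : 0 ≤ ∑ i ∈ Sᶜ, ε i := Finset.sum_nonneg fun i _ => hε i
  linarith

/-- The privacy loss of composed randomized response is attained. -/
lemma exists_isLeast_hockeyStick {k : ℕ} (ε : Fin k → ℝ) (hε : ∀ i, 0 ≤ ε i) {δ : ℝ}
    (hδ : 0 ≤ δ) :
    ∃ g : ℝ, IsLeast {e : ℝ | 0 ≤ e ∧ hockeyStick ε e ≤ δ} g ∧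
      privLoss BitAdj (comp fun i => RR (ε i)) δ = ENNReal.ofReal g := by
  set s : Set ℝ := {e : ℝ | 0 ≤ e ∧ hockeyStick ε e ≤ δ}
  have hc : Continuous fun e => hockeyStick ε e :=
    continuous_hockeyStick.comp (Continuous.prodMk continuous_const continuous_id)
  have hs : IsClosed s := isClosed_Ici.inter (isClosed_le hc continuous_const)
  have hne : s.Nonempty :=
    ⟨∑ i, ε i, Finset.sum_nonneg fun i _ => hε i, (hockeyStick_sum_eq_zero ε hε).trans_le hδ⟩
  have hb : BddBelow s := ⟨0, fun e he => he.1⟩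
  have hm : IsLeast s (sInf s) := ⟨hs.csInf_mem hne hb, fun e he => csInf_le hb he⟩
  refine ⟨sInf s, hm, le_antisymm ?_ ?_⟩
  · refine iInf₂_le_of_le (sInf s).toNNReal ?_ le_rfl
    rw [Real.coe_toNNReal _ hm.1.1]
    exact (isDP_comp_RR_iff ε _ hδ).2 hm.1.2
  · refine le_iInf₂ fun e he => ?_
    rw [← ENNReal.ofReal_coe_nnreal]
    exact ENNReal.ofReal_le_ofReal (hm.2 ⟨e.2, (isDP_comp_RR_iff ε _ hδ).1 he⟩)

lemma hockeyStick_const (k : ℕ) (ε g : ℝ) :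
    hockeyStick (fun _ : Fin k => ε) g =
      1 / (1 + Real.exp ε) ^ k *
        ∑ i ∈ Finset.range (k + 1), (k.choose i : ℝ) *
          max (Real.exp ((i : ℝ) * ε) - Real.exp g * Real.exp (((k : ℝ) - i) * ε)) 0 := by
  unfold hockeyStick
  congr 1
  · simp
  · have h := Finset.sum_powerset_apply_card (x := (Finset.univ : Finset (Fin k))) (fun i : ℕ =>
      max (Real.exp ((i : ℝ) * ε) - Real.exp g * Real.exp (((k : ℝ) - i) * ε)) 0)
    rw [Finset.powerset_univ, Finset.card_univ, Fintype.card_fin] at h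
    simp only [nsmul_eq_mul] at h
    rw [← h]
    refine Finset.sum_congr rfl fun S _ => ?_
    have hS : ((Sᶜ.card : ℕ) : ℝ) = (k : ℝ) - S.card := by
      rw [Finset.card_compl, Fintype.card_fin, Nat.cast_sub (by simpa using S.card_le_univ)]
    simp [hS]

/-- Chernoff bound: the moment generating function of the privacy loss of one randomized response
is `cosh ((t + 1 / 2) ε) / cosh (ε / 2)`. -/
lemma hockeyStick_const_le (k : ℕ) (ε g t : ℝ) (ht : 0 ≤ t) :
    hockeyStick (fun _ : Fin k => ε) g ≤
      Real.exp (k * ((t + 1 / 2) * ε) ^ 2 / 2 - t * g) := by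
  have hpos : (0 : ℝ) < ∏ _i : Fin k, (1 + Real.exp ε) := Finset.prod_pos fun i _ => by positivity
  -- `max (1 - e^(-z)) 0 ≤ e^(t z)`
  have hterm : ∀ a b : ℝ, max (Real.exp a - Real.exp g * Real.exp b) 0 ≤
      Real.exp (-(t * g)) * (Real.exp ((1 + t) * a) * Real.exp (-t * b)) := by
    intro a b
    refine max_le ?_ (by positivity)
    rw [← Real.exp_add, ← Real.exp_add, ← Real.exp_add]
    rcases le_total (g + b) a with h | h
    · have h1 : Real.exp a ≤ Real.exp (-(t * g) + ((1 + t) * a + -t * b)) := by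
        rw [Real.exp_le_exp]; nlinarith
      linarith [Real.exp_pos (g + b)]
    · have h1 : Real.exp a ≤ Real.exp (g + b) := Real.exp_le_exp.2 h
      linarith [Real.exp_pos (-(t * g) + ((1 + t) * a + -t * b))]
  have hsum : ∑ S : Finset (Fin k), (∏ _i ∈ S, Real.exp ((1 + t) * ε)) *
      ∏ _i ∈ Sᶜ, Real.exp (-t * ε) =
      ∏ _i : Fin k, (Real.exp ((1 + t) * ε) + Real.exp (-t * ε)) := by
    rw [Finset.prod_add, Finset.powerset_univ]
    simp [Finset.compl_eq_univ_sdiff]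
  have hone : Real.exp ((1 + t) * ε) + Real.exp (-t * ε) ≤
      (1 + Real.exp ε) * Real.exp (((t + 1 / 2) * ε) ^ 2 / 2) := by
    have e1 : Real.exp ((1 + t) * ε) + Real.exp (-t * ε) =
        Real.exp (ε / 2) * (2 * Real.cosh ((t + 1 / 2) * ε)) := by
      rw [Real.cosh_eq, mul_div_cancel₀ _ two_ne_zero, mul_add, ← Real.exp_add, ← Real.exp_add]
      ring_nf
    have e2 : 1 + Real.exp ε = Real.exp (ε / 2) * (2 * Real.cosh (ε / 2)) := by
      rw [Real.cosh_eq, mul_div_cancel₀ _ two_ne_zero, mul_add, ← Real.exp_add, ← Real.exp_add]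
      ring_nf
      simp [add_comm]
    rw [e1, e2, mul_assoc]
    gcongr
    · linarith [Real.one_le_cosh (ε / 2)]
    · exact Real.cosh_le_exp_half_sq _
  unfold hockeyStick
  rw [one_div, inv_mul_le_iff₀ hpos]
  calc _ ≤ ∑ S : Finset (Fin k), Real.exp (-(t * g)) *
        ((∏ _i ∈ S, Real.exp ((1 + t) * ε)) * ∏ _i ∈ Sᶜ, Real.exp (-t * ε)) := by
        refine Finset.sum_le_sum fun S _ => (hterm _ _).trans (le_of_eq ?_)
        rw [Finset.mul_sum, Finset.mul_sum, Real.exp_sum, Real.exp_sum]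
    _ = Real.exp (-(t * g)) * ∏ _i : Fin k, (Real.exp ((1 + t) * ε) + Real.exp (-t * ε)) := by
        rw [← Finset.mul_sum, hsum]
    _ ≤ Real.exp (-(t * g)) *
        ∏ _i : Fin k, ((1 + Real.exp ε) * Real.exp (((t + 1 / 2) * ε) ^ 2 / 2)) := by
        gcongr
    _ = _ := by
        rw [Finset.prod_mul_distrib]
        simp only [Finset.prod_const, Finset.card_univ, Fintype.card_fin]
        rw [← Real.exp_nat_mul, mul_left_comm, ← Real.exp_add]
        ring_nf

/-- Advanced composition for randomized response, with constant `3`. -/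
lemma hockeyStick_advanced (k : ℕ) (ε δ : ℝ) (hε : 0 ≤ ε) (hk : (k : ℝ) * ε ^ 2 < 1)
    (hδ : 0 < δ) (hδ' : δ < 1 / 2) :
    hockeyStick (fun _ : Fin k => ε) (3 * √(k * Real.log (1 / δ)) * ε) ≤ δ := by
  have hl : 1 / 2 ≤ Real.log (1 / δ) := by
    have h2 : Real.log 2 ≤ Real.log (1 / δ) := by
      apply Real.log_le_log (by norm_num)
      rw [le_div_iff₀ hδ]; linarith
    linarith [Real.log_two_gt_d9]
  have hδl : Real.exp (-Real.log (1 / δ)) = δ := by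
    rw [one_div, Real.log_inv, neg_neg, Real.exp_log hδ]
  set l := Real.log (1 / δ)
  have hk0 : (0 : ℝ) ≤ k := k.cast_nonneg
  rcases (mul_nonneg (Real.sqrt_nonneg (k : ℝ)) hε).eq_or_lt with hs | hs
  · -- no mechanism, or perfect privacy
    have h0 : 3 * √(k * l) * ε = ∑ _i : Fin k, ε := by
      have h1 : √(k * l) * ε = 0 := by
        rw [Real.sqrt_mul hk0, mul_right_comm, ← hs, zero_mul]
      have h2 : (k : ℝ) * ε = 0 := by
        rw [← Real.mul_self_sqrt hk0, mul_assoc, ← hs, mul_zero]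
      rw [mul_assoc, h1]
      simp [h2]
    rw [h0, hockeyStick_sum_eq_zero _ fun _ => hε]
    exact hδ.le
  · -- the Chernoff bound at the (nearly) optimal exponent `t = √l / (√k ε)`
    refine (hockeyStick_const_le k ε _ (√l / (√k * ε)) (by positivity)).trans ?_
    rw [← hδl, Real.exp_le_exp]
    set s := √(k : ℝ) * ε with hsdef
    have hss : s ^ 2 = k * ε ^ 2 := by rw [hsdef, mul_pow, Real.sq_sqrt hk0]
    have hll : √l ^ 2 = l := Real.sq_sqrt (by linarith)
    have h1 : √l / s * (3 * √(k * l) * ε) = 3 * l := by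
      rw [Real.sqrt_mul hk0, show √l / s * (3 * (√(k : ℝ) * √l) * ε) = 3 * √l ^ 2 * (s / s) by
        rw [hsdef]; ring, div_self hs.ne', hll, mul_one]
    have h2 : (k : ℝ) * ((√l / s + 1 / 2) * ε) ^ 2 = (√l + s / 2) ^ 2 := by
      rw [mul_pow, mul_left_comm, ← hss, ← mul_pow]
      congr 1
      field_simp
    rw [h1, h2]
    nlinarith [sq_nonneg (√l - s / 2)]

/-! ### Signed combinations of laws of sequences -/

/-- The inequality `0 ≤ ∑ c, κ c * P c T` extends from the events that prescribe finitely many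
initial messages to all events: every event is approximated, with respect to `∑ c, P c`, by an event
that depends on finitely many messages, and the latter is a countable disjoint union of such
prescriptions. -/
lemma sum_mul_measureReal_nonneg {ι B : Type*} [Fintype ι] [Countable B] [MeasurableSpace B]
    [DiscreteMeasurableSpace B] (P : ι → Measure (ℕ → B)) [∀ c, IsFiniteMeasure (P c)] (κ : ι → ℝ)
    (h : ∀ (n : ℕ) (a : ℕ → B), 0 ≤ ∑ c, κ c * (P c).real {f | ∀ i < n, f i = a i})
    {T : Set (ℕ → B)} (hT : MeasurableSet T) : 0 ≤ ∑ c, κ c * (P c).real T := by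
  have hcyl : ∀ S ∈ measurableCylinders (fun _ : ℕ => B), 0 ≤ ∑ c, κ c * (P c).real S := by
    intro S hS
    rw [measurableCylinders_nat] at hS
    simp only [Set.mem_iUnion, Set.mem_singleton_iff] at hS
    obtain ⟨n, U, -, rfl⟩ := hS
    have hsum : ∀ c, HasSum
        (fun s : U => (P c).real ((Finset.Iic n).restrict ⁻¹' {(s : Finset.Iic n → B)}))
        ((P c).real (cylinder (Finset.Iic n) U)) := by
      intro c
      have e : (P c) (cylinder (Finset.Iic n) U) =
          ∑' s : U, (P c) ((Finset.Iic n).restrict ⁻¹' {(s : Finset.Iic n → B)}) := by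
        rw [cylinder, tsum_measure_preimage_singleton (Set.to_countable U)]
        exact fun s _ => Finset.measurable_restrict _ (measurableSet_singleton s)
      have hne : ∑' s : U, (P c) ((Finset.Iic n).restrict ⁻¹' {(s : Finset.Iic n → B)}) ≠ ∞ := by
        rw [← e]; finiteness
      have := ENNReal.hasSum_toReal hne
      rwa [← ENNReal.tsum_toReal_eq fun s => by finiteness, ← e] at this
    refine (hasSum_sum fun c _ => (hsum c).mul_left (κ c)).nonneg fun s => ?_
    rcases Set.eq_empty_or_nonempty ((Finset.Iic n).restrict ⁻¹' {(s : Finset.Iic n → B)} :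
      Set (ℕ → B)) with hs | ⟨a, ha⟩
    · simp [hs]
    · convert! h (n + 1) a using 5 with c
      ext f
      simp only [Set.mem_preimage, Set.mem_singleton_iff, Set.mem_ofPred_eq] at ha ⊢
      rw [← ha, funext_iff]
      simp
  by_contra! hneg
  let C := ∑ c, |κ c|
  have hC : 0 ≤ C := Finset.sum_nonneg fun c _ => abs_nonneg _
  obtain ⟨S, hS, hST⟩ := (Measure.MeasureDense.of_generateFrom_isSetAlgebra_finite
    (μ := ∑ c, P c) isSetAlgebra_measurableCylinders generateFrom_measurableCylinders.symm).approx
    T hT (by finiteness) (-(∑ c, κ c * (P c).real T) / (C + 1))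
    (div_pos (neg_pos.2 hneg) (by positivity))
  have hSm := MeasurableSet.of_mem_measurableCylinders hS
  set η := -(∑ c, κ c * (P c).real T) / (C + 1) with hη
  have hηpos : 0 < η := div_pos (neg_pos.2 hneg) (by positivity)
  have hd : ∀ c, κ c * (P c).real S - κ c * (P c).real T ≤ |κ c| * η := by
    intro c
    have h1 : (P c).real (symmDiff T S) ≤ η := by
      refine ENNReal.toReal_le_of_le_ofReal hηpos.le (le_trans ?_ hST.le)
      rw [Measure.finsetSum_apply]
      exact Finset.single_le_sum (f := fun c => P c (symmDiff T S)) (fun _ _ => zero_le)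
        (Finset.mem_univ c)
    have h2 := abs_measureReal_sub_le_measureReal_symmDiff (μ := P c)
      hT.nullMeasurableSet hSm.nullMeasurableSet
    rw [← mul_sub]
    calc κ c * ((P c).real S - (P c).real T) ≤ |κ c * ((P c).real S - (P c).real T)| :=
          le_abs_self _
      _ = |κ c| * |(P c).real T - (P c).real S| := by rw [abs_mul, abs_sub_comm]
      _ ≤ |κ c| * η := by gcongr; exact h2.trans h1
  have h3 := Finset.sum_le_sum fun c (_ : c ∈ Finset.univ) => hd c
  rw [Finset.sum_sub_distrib, ← Finset.sum_mul] at h3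
  have h4 : η * (C + 1) = -(∑ c, κ c * (P c).real T) := by
    rw [hη]; field_simp
  have h5 := hcyl S hS
  change _ ≤ C * η at h3
  linarith

/-- The inverse of the matrix `rrWeight ε`, for `ε > 0`. -/
def rrInv (ε : ℝ) (b c : Bool) : ℝ := (if c = b then Real.exp ε else -1) / (Real.exp ε - 1)

lemma sum_rrInv {ε : ℝ} (hε : 0 < ε) (b : Bool) : ∑ c, rrInv ε b c = 1 := by
  have h : Real.exp ε - 1 ≠ 0 := (sub_pos.2 (Real.one_lt_exp_iff.2 hε)).ne'
  cases b <;> simp only [rrInv, Fintype.sum_bool] <;> simp <;> field_simp <;> ring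

lemma sum_rrWeight_mul_rrInv {ε : ℝ} (hε : 0 < ε) (c c' : Bool) :
    ∑ b, rrWeight ε c b * rrInv ε b c' = if c = c' then 1 else 0 := by
  have h : Real.exp ε - 1 ≠ 0 := (sub_pos.2 (Real.one_lt_exp_iff.2 hε)).ne'
  have h' : 1 + Real.exp ε ≠ 0 := by positivity
  cases c <;> cases c' <;> simp only [rrInv, rrWeight, Fintype.sum_bool] <;> simp <;>
    field_simp <;> ring

lemma sum_rrInv_mul_nonneg {ε : ℝ} (hε : 0 < ε) (p : Bool → ℝ)
    (hp : ∀ c, p c ≤ Real.exp ε * p (!c)) (b : Bool) : 0 ≤ ∑ c, rrInv ε b c * p c := by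
  have h : 0 < Real.exp ε - 1 := sub_pos.2 (Real.one_lt_exp_iff.2 hε)
  have h' := hp (!b)
  rw [Bool.not_not] at h'
  have e : ∑ c, rrInv ε b c * p c = (Real.exp ε * p b - p (!b)) / (Real.exp ε - 1) := by
    cases b <;> simp [rrInv] <;> ring
  rw [e]
  exact div_nonneg (sub_nonneg.2 h') h.le

/-- Simulation by randomized response. Let `P c` be laws of a sequence of messages, indexed by
`k` bits, such that the probability that `P c` assigns to prescribed initial messages is, up to a
constant `w` independent of `c`, a product of factors of which the `j`-th depends only on `c j`, and
changes at most by the factor `e ^ ε j` with it. Then `P c` is the law of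
the post-processing of `Comp(RR)` on input `c` that maps the output `b` to
`ν b = ∑ c, (∏ j, rrInv (ε j) (b j) (c j)) * P c`, which is nonnegative by
`sum_mul_measureReal_nonneg`. So `P` satisfies the privacy guarantees of `Comp(RR)`. -/
lemma measureReal_le_hockeyStick_of_pos {B : Type*} [Countable B] [MeasurableSpace B]
    [DiscreteMeasurableSpace B] {k : ℕ} (ε : Fin k → ℝ) (hε : ∀ j, 0 < ε j)
    (P : (Fin k → Bool) → Measure (ℕ → B)) [∀ c, IsProbabilityMeasure (P c)]
    (hP : ∀ (n : ℕ) (a : ℕ → B), ∃ (w : ℝ) (p : Fin k → Bool → ℝ), 0 ≤ w ∧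
      (∀ j c, p j c ≤ Real.exp (ε j) * p j (!c)) ∧
      ∀ c, (P c).real {f | ∀ i < n, f i = a i} = w * ∏ j, p j (c j))
    (g : ℝ) {T : Set (ℕ → B)} (hT : MeasurableSet T) :
    (P fun _ => true).real T ≤
      Real.exp g * (P fun _ => false).real T + hockeyStick ε g := by
  let ν (b : Fin k → Bool) (S : Set (ℕ → B)) : ℝ :=
    ∑ c, (∏ j, rrInv (ε j) (b j) (c j)) * (P c).real S
  have hν0 : ∀ b S, MeasurableSet S → 0 ≤ ν b S := by
    intro b S hS
    refine sum_mul_measureReal_nonneg P _ (fun n a => ?_) hS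
    obtain ⟨w, p, hw, hp, hc⟩ := hP n a
    have e : ∑ c : Fin k → Bool,
        (∏ j, rrInv (ε j) (b j) (c j)) * (P c).real {f | ∀ i < n, f i = a i} =
        w * ∏ j, ∑ c, rrInv (ε j) (b j) c * p j c := by
      rw [Fintype.prod_sum, Finset.mul_sum]
      refine Finset.sum_congr rfl fun c _ => ?_
      rw [hc, Finset.prod_mul_distrib]
      ring
    rw [e]
    exact mul_nonneg hw (Finset.prod_nonneg fun j _ => sum_rrInv_mul_nonneg (hε j) _ (hp j) _)
  have hν1 : ∀ b S, MeasurableSet S → ν b S ≤ 1 := by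
    intro b S hS
    have e : ν b S + ν b Sᶜ = 1 := by
      simp only [ν, ← Finset.sum_add_distrib, ← mul_add, measureReal_add_measureReal_compl hS,
        probReal_univ, mul_one]
      rw [← Fintype.prod_sum]
      exact Finset.prod_eq_one fun j _ => sum_rrInv (hε j) _
    linarith [hν0 b Sᶜ hS.compl]
  have hdec : ∀ c, (P c).real T = ∑ b, (∏ j, rrWeight (ε j) (c j) (b j)) * ν b T := by
    intro c
    have hprod : ∀ c' : Fin k → Bool,
        ∑ b : Fin k → Bool, ∏ j, rrWeight (ε j) (c j) (b j) * rrInv (ε j) (b j) (c' j) =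
          ∏ j, if c j = c' j then 1 else 0 := by
      intro c'
      refine Eq.trans ?_ (Finset.prod_congr rfl fun j _ =>
        sum_rrWeight_mul_rrInv (hε j) (c j) (c' j))
      rw [Fintype.prod_sum]
    simp only [ν, Finset.mul_sum, ← mul_assoc, ← Finset.prod_mul_distrib]
    rw [Finset.sum_comm]
    simp only [← Finset.sum_mul, hprod]
    rw [Finset.sum_eq_single c]
    · simp
    · intro c' _ hc'
      obtain ⟨j, hj⟩ := Function.ne_iff.1 hc'
      rw [Finset.prod_eq_zero (Finset.mem_univ j) (if_neg hj.symm), zero_mul]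
    · simp
  rw [← sub_le_iff_le_add', hdec, hdec, Finset.mul_sum, ← Finset.sum_sub_distrib,
    ← sum_max_rrWeight ε g true]
  refine Finset.sum_le_sum fun b _ => ?_
  rw [← mul_assoc, ← sub_mul]
  calc _ ≤ max ((∏ j, rrWeight (ε j) true (b j)) -
        Real.exp g * ∏ j, rrWeight (ε j) (!true) (b j)) 0 * ν b T :=
        mul_le_mul_of_nonneg_right (le_max_left _ _) (hν0 b T hT)
    _ ≤ _ := mul_le_of_le_one_right (le_max_right _ _) (hν1 b T hT)

/-- Simulation by randomized response for `ε ≥ 0`, as the limit of the bounds for `ε + η` with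
`η > 0`. -/
lemma measureReal_le_hockeyStick {B : Type*} [Countable B] [MeasurableSpace B]
    [DiscreteMeasurableSpace B] {k : ℕ} (ε : Fin k → ℝ) (hε : ∀ j, 0 ≤ ε j)
    (P : (Fin k → Bool) → Measure (ℕ → B)) [∀ c, IsProbabilityMeasure (P c)]
    (hP : ∀ (n : ℕ) (a : ℕ → B), ∃ (w : ℝ) (p : Fin k → Bool → ℝ), 0 ≤ w ∧ (∀ j c, 0 ≤ p j c) ∧
      (∀ j c, p j c ≤ Real.exp (ε j) * p j (!c)) ∧
      ∀ c, (P c).real {f | ∀ i < n, f i = a i} = w * ∏ j, p j (c j))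
    (g : ℝ) {T : Set (ℕ → B)} (hT : MeasurableSet T) :
    (P fun _ => true).real T ≤
      Real.exp g * (P fun _ => false).real T + hockeyStick ε g := by
  have hc : Continuous fun η : ℝ => Real.exp g * (P fun _ => false).real T +
      hockeyStick (fun j => ε j + η) g :=
    continuous_const.add (continuous_hockeyStick.comp
      (Continuous.prodMk (f := fun η : ℝ => fun j => ε j + η) (by fun_prop) continuous_const))
  have hlim := (hc.tendsto 0).mono_left (nhdsWithin_le_nhds (s := Set.Ioi 0))
  simp only [add_zero] at hlim
  refine ge_of_tendsto hlim ?_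
  filter_upwards [self_mem_nhdsWithin] with η hη
  refine measureReal_le_hockeyStick_of_pos _ (fun j => add_pos_of_nonneg_of_pos (hε j) hη) P
    (fun n a => ?_) g hT
  obtain ⟨w, p, hw, hp0, hp, hc⟩ := hP n a
  refine ⟨w, p, hw, fun j c => (hp j c).trans ?_, hc⟩
  exact mul_le_mul_of_nonneg_right (Real.exp_le_exp.2 (by linarith [Set.mem_Ioi.1 hη])) (hp0 _ _)

variable {D : Type*} {E : Type*} {Q : Type*} {A : Type*}

/-- The σ-algebra on single messages. -/
abbrev messageMeasurableSpace (A : Type*) : MeasurableSpace (Option A) := ⊤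

attribute [local instance] messageMeasurableSpace

/-! ### Interactions and their histories -/

/-- The queries in `H` are those that `𝒜` sends when it receives the answers in `H`. -/
def Asks (𝒜 : Adversary Q A) (H : List (Q × A)) (r : 𝒜.Coins) : Prop :=
  ∀ h m, h ++ [m] <+: H → 𝒜.ask (h.map Prod.snd) r = some m.1

/-- The answers in `H` are those that `M` sends when it receives the queries in `H`. -/
def Answers (M : InteractiveMechanism D Q A) (x : D) (H : List (Q × A)) (r : M.Coins) : Prop :=
  ∀ h m, h ++ [m] <+: H → M.respond x (h.map Prod.fst ++ [m.1]) r = some m.2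

/-- `M` answers the queries in `H` as in `H`, and halts on the query in `o`, if there is one. -/
def Outcome (M : InteractiveMechanism D Q A) (x : D) (H : List (Q × A)) (o : Option Q)
    (r : M.Coins) : Prop :=
  Answers M x H r ∧ ∀ q ∈ o, M.respond x (H.map Prod.fst ++ [q]) r = none

@[simp] lemma asks_nil (𝒜 : Adversary Q A) (r : 𝒜.Coins) : Asks 𝒜 [] r := by
  simp [Asks]

@[simp] lemma answers_nil (M : InteractiveMechanism D Q A) (x : D) (r : M.Coins) :
    Answers M x [] r := by
  simp [Answers]

lemma asks_append (𝒜 : Adversary Q A) (H : List (Q × A)) (m : Q × A) (r : 𝒜.Coins) :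
    Asks 𝒜 (H ++ [m]) r ↔ Asks 𝒜 H r ∧ 𝒜.ask (H.map Prod.snd) r = some m.1 := by
  simp only [Asks, List.prefix_concat_iff]
  constructor
  · exact fun h => ⟨fun h' m' hm => h h' m' (Or.inr hm), h H m (Or.inl rfl)⟩
  · rintro ⟨h1, h2⟩ h' m' (hm | hm)
    · obtain ⟨rfl, hm⟩ := List.append_inj' hm rfl
      obtain rfl : m' = m := by simpa using hm
      exact h2
    · exact h1 h' m' hm

lemma answers_append (M : InteractiveMechanism D Q A) (x : D) (H : List (Q × A)) (m : Q × A)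
    (r : M.Coins) : Answers M x (H ++ [m]) r ↔
      Answers M x H r ∧ M.respond x (H.map Prod.fst ++ [m.1]) r = some m.2 := by
  simp only [Answers, List.prefix_concat_iff]
  constructor
  · exact fun h => ⟨fun h' m' hm => h h' m' (Or.inr hm), h H m (Or.inl rfl)⟩
  · rintro ⟨h1, h2⟩ h' m' (hm | hm)
    · obtain ⟨rfl, hm⟩ := List.append_inj' hm rfl
      obtain rfl : m' = m := by simpa using hm
      exact h2
    · exact h1 h' m' hm

lemma measurableSet_asks (𝒜 : Adversary Q A) (H : List (Q × A)) :
    MeasurableSet {r | Asks 𝒜 H r} := by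
  induction H using List.reverseRecOn with
  | nil => simp
  | append_singleton H m ih =>
    simp only [asks_append]
    exact ih.inter (𝒜.measurableSet_ask _ _)

lemma measurableSet_answers (M : InteractiveMechanism D Q A) (x : D) (H : List (Q × A)) :
    MeasurableSet {r | Answers M x H r} := by
  induction H using List.reverseRecOn with
  | nil => simp
  | append_singleton H m ih =>
    simp only [answers_append]
    exact ih.inter (M.measurableSet_respond _ _ _)

lemma transcript_eq_some_iff (𝒜 : Adversary Q A) (M : InteractiveMechanism D Q A) (x : D)
    (rA : 𝒜.Coins) (rM : M.Coins) (n : ℕ) (H : List (Q × A)) :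
    transcript 𝒜 M x rA rM n = some H ↔ H.length = n ∧ Asks 𝒜 H rA ∧ Answers M x H rM := by
  induction n generalizing H with
  | zero =>
    simp only [transcript, Option.some.injEq, List.length_eq_zero_iff]
    constructor
    · rintro rfl; simp
    · exact fun h => h.1.symm
  | succ n ih =>
    simp only [transcript, Option.bind_eq_some_iff, Option.map_eq_some_iff]
    constructor
    · rintro ⟨h, h1, q, h2, a, h3, rfl⟩
      obtain ⟨e1, e2, e3⟩ := (ih h).1 h1
      exact ⟨by simp [e1], (asks_append ..).2 ⟨e2, h2⟩, (answers_append ..).2 ⟨e3, h3⟩⟩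
    · rintro ⟨e1, e2, e3⟩
      rcases List.eq_nil_or_concat' H with rfl | ⟨h, m, rfl⟩
      · simp at e1
      · obtain ⟨f1, f2⟩ := (asks_append ..).1 e2
        obtain ⟨g1, g2⟩ := (answers_append ..).1 e3
        exact ⟨h, (ih h).2 ⟨by simpa using e1, f1, g1⟩, m.1, f2, m.2, g2, rfl⟩

lemma view_snd_of_transcript (𝒜 : Adversary Q A) (M : InteractiveMechanism D Q A) (x : D)
    (rA : 𝒜.Coins) (rM : M.Coins) {n : ℕ} {H : List (Q × A)}
    (h : transcript 𝒜 M x rA rM n = some H) :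
    (view 𝒜 M x rA rM).2 n =
      (𝒜.ask (H.map Prod.snd) rA).bind fun q => M.respond x (H.map Prod.fst ++ [q]) rM := by
  simp only [view, transcript, h, Option.bind_some]
  cases 𝒜.ask (H.map Prod.snd) rA with
  | none => rfl
  | some q => cases h' : M.respond x (H.map Prod.fst ++ [q]) rM <;> simp [h']

lemma view_snd_of_transcript_none (𝒜 : Adversary Q A) (M : InteractiveMechanism D Q A) (x : D)
    (rA : 𝒜.Coins) (rM : M.Coins) {n : ℕ} (h : transcript 𝒜 M x rA rM n = none) :
    (view 𝒜 M x rA rM).2 n = none := by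
  simp [view, transcript, h]

lemma view_snd_eq_some_iff (𝒜 : Adversary Q A) (M : InteractiveMechanism D Q A) (x : D)
    (rA : 𝒜.Coins) (rM : M.Coins) (n : ℕ) (a : A) :
    (view 𝒜 M x rA rM).2 n = some a ↔
      ∃ (H : List (Q × A)) (q : Q), transcript 𝒜 M x rA rM (n + 1) = some (H ++ [(q, a)]) := by
  simp only [view, Option.bind_eq_some_iff]
  constructor
  · rintro ⟨H, h1, h2⟩
    rcases List.eq_nil_or_concat' H with rfl | ⟨h, m, rfl⟩
    · simp at h2
    · obtain rfl : m.2 = a := by simpa using h2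
      exact ⟨h, m.1, h1⟩
  · rintro ⟨H, q, h⟩
    exact ⟨_, h, by simp⟩

/-- If `𝒜` asks the queries in `H` as long as it gets the answers in `H`, then it gets them iff `M`
gives them. -/
lemma view_snd_eq_iff_answers (𝒜 : Adversary Q A) (M : InteractiveMechanism D Q A) (x : D)
    (rA : 𝒜.Coins) (rM : M.Coins) (H : List (Q × A)) (hH : Asks 𝒜 H rA) :
    (∀ i < H.length, (view 𝒜 M x rA rM).2 i = (H.map Prod.snd)[i]?) ↔ Answers M x H rM := by
  induction H using List.reverseRecOn with
  | nil => simp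
  | append_singleton H m ih =>
    obtain ⟨h1, h2⟩ := (asks_append ..).1 hH
    rw [answers_append, ← ih h1]
    have key : Answers M x H rM → ((view 𝒜 M x rA rM).2 H.length = some m.2 ↔
        M.respond x (H.map Prod.fst ++ [m.1]) rM = some m.2) := by
      intro h3
      rw [view_snd_of_transcript 𝒜 M x rA rM
        ((transcript_eq_some_iff 𝒜 M x rA rM _ H).2 ⟨rfl, h1, h3⟩), h2, Option.bind_some]
    have hlt : ∀ i < H.length, ((H ++ [m]).map Prod.snd)[i]? = (H.map Prod.snd)[i]? := by
      intro i hi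
      rw [List.map_append, List.getElem?_append_left (by simpa using hi)]
    have heq : ((H ++ [m]).map Prod.snd)[H.length]? = some m.2 := by simp
    constructor
    · intro h
      have h4 : ∀ i < H.length, (view 𝒜 M x rA rM).2 i = (H.map Prod.snd)[i]? := fun i hi => by
        rw [h i (by simp; omega), hlt i hi]
      refine ⟨h4, (key ((ih h1).1 h4)).1 ?_⟩
      rw [h _ (by simp), heq]
    · rintro ⟨h4, h5⟩ i hi
      rcases Nat.lt_succ_iff_lt_or_eq.1 (by simpa using hi : i < H.length + 1) with hi | rfl
      · rw [h4 i hi, hlt i hi]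
      · rw [heq, (key ((ih h1).1 h4)).2 h5]

/-- For fixed coins of the adversary, prescribing its first `n` messages is either impossible, or
equivalent to prescribing the answers to certain queries, and possibly `halt` after that. -/
lemma view_prefix_iff_outcome (𝒜 : Adversary Q A) (M : InteractiveMechanism D Q A) (rA : 𝒜.Coins)
    (n : ℕ) (a : ℕ → Option A) :
    (∀ x rM, ¬ ∀ i < n, (view 𝒜 M x rA rM).2 i = a i) ∨
      ∃ H o, ∀ x rM, (∀ i < n, (view 𝒜 M x rA rM).2 i = a i) ↔ Outcome M x H o rM := by
  -- In the second case, the induction distinguishes whether the interaction is over.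
  suffices h : (∀ x rM, ¬ ∀ i < n, (view 𝒜 M x rA rM).2 i = a i) ∨
      (∃ H, H.length = n ∧ Asks 𝒜 H rA ∧
        ∀ x rM, (∀ i < n, (view 𝒜 M x rA rM).2 i = a i) ↔ Answers M x H rM) ∨
      ∃ H o, ∀ x rM, ((∀ i < n, (view 𝒜 M x rA rM).2 i = a i) ↔ Outcome M x H o rM) ∧
        (Outcome M x H o rM → transcript 𝒜 M x rA rM n = none) by
    rcases h with h | ⟨H, -, -, h⟩ | ⟨H, o, h⟩
    · exact Or.inl h
    · exact Or.inr ⟨H, none, fun x rM => by simp [h, Outcome]⟩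
    · exact Or.inr ⟨H, o, fun x rM => (h x rM).1⟩
  induction n with
  | zero => exact Or.inr (Or.inl ⟨[], by simp⟩)
  | succ n ih =>
    simp only [Nat.forall_lt_succ_right]
    rcases ih with h | ⟨H, hn, hA, h⟩ | ⟨H, o, h⟩
    · exact Or.inl fun x rM h' => h x rM h'.1
    · have hview : ∀ x rM, Answers M x H rM → (view 𝒜 M x rA rM).2 n =
          (𝒜.ask (H.map Prod.snd) rA).bind fun q => M.respond x (H.map Prod.fst ++ [q]) rM :=
        fun x rM h' => view_snd_of_transcript 𝒜 M x rA rM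
          ((transcript_eq_some_iff 𝒜 M x rA rM _ H).2 ⟨hn, hA, h'⟩)
      cases hq : 𝒜.ask (H.map Prod.snd) rA with
      | none =>
        cases ha : a n with
        | none =>
          refine Or.inr (Or.inr ⟨H, none, fun x rM => ⟨?_, fun h' => ?_⟩⟩)
          · simp only [h, Outcome, Option.not_mem_none, false_imp_iff, implies_true, and_true,
              and_iff_left_iff_imp]
            intro h'
            simp [hview x rM h', hq]
          · rw [transcript, (transcript_eq_some_iff 𝒜 M x rA rM _ H).2 ⟨hn, hA, h'.1⟩]
            simp [hq]
        | some y =>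
          refine Or.inl fun x rM h' => ?_
          have := hview x rM ((h x rM).1 h'.1)
          simp [hq, h'.2] at this
      | some q =>
        cases ha : a n with
        | none =>
          refine Or.inr (Or.inr ⟨H, some q, fun x rM => ⟨?_, fun h' => ?_⟩⟩)
          · simp only [h, Outcome, Option.mem_some_iff, forall_eq']
            refine and_congr_right fun h' => ?_
            rw [hview x rM h', hq, Option.bind_some]
          · rw [transcript, (transcript_eq_some_iff 𝒜 M x rA rM _ H).2 ⟨hn, hA, h'.1⟩]
            simp [hq, h'.2 q rfl]
        | some y =>
          refine Or.inr (Or.inl ⟨H ++ [(q, y)], by simp [hn], (asks_append ..).2 ⟨hA, hq⟩,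
            fun x rM => ?_⟩)
          rw [answers_append, h]
          refine and_congr_right fun h' => ?_
          rw [hview x rM h', hq, Option.bind_some]
    · cases ha : a n with
      | none =>
        refine Or.inr (Or.inr ⟨H, o, fun x rM => ⟨?_, fun h' => ?_⟩⟩)
        · rw [(h x rM).1]
          exact and_iff_left_of_imp fun h' => view_snd_of_transcript_none _ _ _ _ _ ((h x rM).2 h')
        · rw [transcript, (h x rM).2 h', Option.bind_none]
      | some y =>
        refine Or.inl fun x rM h' => ?_
        have := view_snd_of_transcript_none _ _ _ _ _ ((h x rM).2 ((h x rM).1.1 h'.1))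
        simp [h'.2] at this

/-! ### Laws of views -/

lemma measurable_view [Countable Q] [Countable A] (𝒜 : Adversary Q A)
    (M : InteractiveMechanism D Q A) (x : D) :
    Measurable fun r : 𝒜.Coins × M.Coins => view 𝒜 M x r.1 r.2 := by
  refine measurable_fst.prodMk (measurable_pi_lambda _ fun n => ?_)
  have hs : ∀ a : A, MeasurableSet
      ((fun r : 𝒜.Coins × M.Coins => (view 𝒜 M x r.1 r.2).2 n) ⁻¹' {some a}) := by
    intro a
    simp only [Set.preimage, Set.mem_singleton_iff, view_snd_eq_some_iff, transcript_eq_some_iff]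
    simp only [Set.ofPred_exists]
    refine MeasurableSet.iUnion fun H => MeasurableSet.iUnion fun q => ?_
    refine (MeasurableSet.const _).inter ?_
    exact (measurable_fst (measurableSet_asks 𝒜 _)).inter
      (measurable_snd (measurableSet_answers M x _))
  refine measurable_to_countable' fun y => ?_
  cases y with
  | some a => exact hs a
  | none =>
    convert (MeasurableSet.iUnion hs).compl using 1
    ext r
    simp only [Set.mem_preimage, Set.mem_singleton_iff, Set.mem_compl_iff, Set.mem_iUnion,
      not_exists, Option.eq_none_iff_forall_ne_some]
    rfl

lemma measurable_view_snd [Countable Q] [Countable A] (𝒜 : Adversary Q A)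
    (M : InteractiveMechanism D Q A) (x : D) (rA : 𝒜.Coins) :
    Measurable fun rM : M.Coins => (view 𝒜 M x rA rM).2 :=
  measurable_snd.comp ((measurable_view 𝒜 M x).comp measurable_prodMk_left)

lemma probView_eq_lintegral [Countable Q] [Countable A] (𝒜 : Adversary Q A)
    (M : InteractiveMechanism D Q A) (x : D) {T : Set (𝒜.Coins × (ℕ → Option A))}
    (hT : MeasurableSet[viewMeasurableSpace 𝒜] T) :
    probView 𝒜 M x T = ∫⁻ rA, M.coinLaw {rM | view 𝒜 M x rA rM ∈ T} ∂𝒜.coinLaw :=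
  Measure.prod_apply (measurable_view 𝒜 M x hT)

/-- It suffices to bound the answers for fixed coins of the adversary. -/
lemma probView_le_of_forall_coins [Countable Q] [Countable A] (𝒜 : Adversary Q A)
    (M : InteractiveMechanism D Q A) (x x' : D) (g δ : ℝ)
    (h : ∀ (rA : 𝒜.Coins) (S : Set (ℕ → Option A)), MeasurableSet S →
      M.coinLaw {rM | (view 𝒜 M x rA rM).2 ∈ S} ≤ ENNReal.ofReal (Real.exp g) *
        M.coinLaw {rM | (view 𝒜 M x' rA rM).2 ∈ S} + ENNReal.ofReal δ)
    {T : Set (𝒜.Coins × (ℕ → Option A))} (hT : MeasurableSet[viewMeasurableSpace 𝒜] T) :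
    probView 𝒜 M x T ≤ ENNReal.ofReal (Real.exp g) * probView 𝒜 M x' T + ENNReal.ofReal δ := by
  rw [probView_eq_lintegral 𝒜 M x hT, probView_eq_lintegral 𝒜 M x' hT]
  calc _ ≤ ∫⁻ rA, (ENNReal.ofReal (Real.exp g) * M.coinLaw {rM | view 𝒜 M x' rA rM ∈ T} +
        ENNReal.ofReal δ) ∂𝒜.coinLaw :=
        lintegral_mono fun rA => h rA (Prod.mk rA ⁻¹' T) (measurable_prodMk_left hT)
    _ = _ := by
        rw [lintegral_add_right _ measurable_const, lintegral_const_mul' _ _ ENNReal.ofReal_ne_top,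
          lintegral_const, measure_univ, mul_one]

/-- The adversary that asks the queries in `qs` and then halts. -/
def scriptedAdversary (A : Type*) (qs : List Q) : Adversary Q A where
  Coins := Unit
  coinLaw := Measure.dirac ()
  ask h _ := qs[h.length]?
  measurableSet_ask _ _ := MeasurableSet.of_discrete

lemma asks_scriptedAdversary (qs : List Q) (H : List (Q × A)) (h : H.map Prod.fst <+: qs)
    (r : (scriptedAdversary A qs).Coins) : Asks (scriptedAdversary A qs) H r := by
  intro h' m hm
  obtain ⟨t, rfl⟩ := hm
  obtain ⟨s, rfl⟩ := h
  simp [scriptedAdversary]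

lemma probView_scriptedAdversary [Countable Q] [Countable A] (qs : List Q)
    (M : InteractiveMechanism D Q A) (x : D) {S : Set (ℕ → Option A)} (hS : MeasurableSet S) :
    probView (scriptedAdversary A qs) M x (Prod.snd ⁻¹' S) =
      M.coinLaw {rM | (view (scriptedAdversary A qs) M x () rM).2 ∈ S} := by
  rw [probView_eq_lintegral _ _ _ (measurable_snd hS)]
  exact lintegral_dirac (α := Unit) () _

/-- Pure differential privacy bounds the probability of each single outcome. -/
lemma InteractiveMechanism.IsDP.outcome_le [Countable Q] [Countable A] {adj : D → D → Prop}
    {M : InteractiveMechanism D Q A} {ε : ℝ} (hM : M.IsDP adj ε 0) {x x' : D} (hx : adj x x')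
    (H : List (Q × A)) (o : Option Q) :
    M.coinLaw.real {r | Outcome M x H o r} ≤
      Real.exp ε * M.coinLaw.real {r | Outcome M x' H o r} := by
  obtain ⟨qs, hqs⟩ : ∃ qs, qs = H.map Prod.fst ++ o.toList := ⟨_, rfl⟩
  have hA : Asks (scriptedAdversary A qs) H () :=
    asks_scriptedAdversary _ _ (hqs ▸ List.prefix_append _ _) _
  have ho : (scriptedAdversary A qs).ask (H.map Prod.snd) () = o := by
    cases o <;> simp [scriptedAdversary, hqs]
  let S : Set (ℕ → Option A) :=
    {f | (∀ i < H.length, f i = (H.map Prod.snd)[i]?) ∧ ∀ q ∈ o, f H.length = none}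
  have hm : ∀ (i : ℕ) (y : Option A), MeasurableSet {f : ℕ → Option A | f i = y} := fun i y =>
    measurable_pi_apply (X := fun _ : ℕ => Option A) i (MeasurableSet.of_discrete (s := {y}))
  have hS : MeasurableSet S := by
    refine MeasurableSet.inter
      (s₁ := {f : ℕ → Option A | ∀ i < H.length, f i = (H.map Prod.snd)[i]?})
      (s₂ := {f : ℕ → Option A | ∀ q ∈ o, f H.length = none}) ?_ ?_
    · simp only [Set.ofPred_forall]
      exact MeasurableSet.iInter fun i => MeasurableSet.iInter fun _ => hm _ _
    · simp only [Set.ofPred_forall]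
      exact MeasurableSet.iInter fun q => MeasurableSet.iInter fun _ => hm _ _
  have hiff : ∀ y, {r | (view (scriptedAdversary A qs) M y () r).2 ∈ S} = {r | Outcome M y H o r} := by
    intro y
    ext r
    change (_ ∧ _) ↔ (_ ∧ _)
    rw [view_snd_eq_iff_answers (scriptedAdversary A qs) M y () r H hA]
    refine and_congr_right fun h => ?_
    rw [view_snd_of_transcript (scriptedAdversary A qs) M y () r
      ((transcript_eq_some_iff (scriptedAdversary A qs) M y () r _ H).2 ⟨rfl, hA, h⟩), ho]
    cases o <;> simp
  have h := hM x x' hx (scriptedAdversary A qs) _ (measurable_snd hS)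
  rw [probView_scriptedAdversary _ _ _ hS, probView_scriptedAdversary _ _ _ hS, hiff, hiff,
    measure_le_iff_real _ _ _ _ _ le_rfl, add_zero] at h
  exact h

/-! ### Concurrent composition of pure mechanisms -/

/-- The part of the history of a concurrent composition that is seen by the `j`-th mechanism. -/
def subhistory {k : ℕ} (j : Fin k) (H : List ((Q × Fin k) × A)) : List (Q × A) :=
  (H.filter fun m => m.1.2 = j).map fun m => (m.1.1, m.2)

lemma subhistory_append {k : ℕ} (j : Fin k) (H : List ((Q × Fin k) × A)) (m : (Q × Fin k) × A) :
    subhistory j (H ++ [m]) = subhistory j H ++ if m.1.2 = j then [(m.1.1, m.2)] else [] := by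
  by_cases h : m.1.2 = j <;> simp [subhistory, h]

lemma conComp_respond {k : ℕ} (M : Fin k → InteractiveMechanism D Q A) (x : D)
    (H : List ((Q × Fin k) × A)) (m : Q × Fin k) (r : (conComp M).Coins) :
    (conComp M).respond x (H.map Prod.fst ++ [m]) r =
      (M m.2).respond x ((subhistory m.2 H).map Prod.fst ++ [m.1]) (r m.2) := by
  simp [conComp, subhistory, List.filter_map, Function.comp_def]

lemma answers_conComp {k : ℕ} (M : Fin k → InteractiveMechanism D Q A) (x : D)
    (H : List ((Q × Fin k) × A)) (r : (conComp M).Coins) :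
    Answers (conComp M) x H r ↔ ∀ j, Answers (M j) x (subhistory j H) (r j) := by
  induction H using List.reverseRecOn with
  | nil => simp [subhistory]
  | append_singleton H m ih =>
    rw [answers_append, ih, conComp_respond]
    simp only [subhistory_append]
    constructor
    · rintro ⟨h1, h2⟩ j
      split_ifs with hj
      · subst hj
        exact (answers_append ..).2 ⟨h1 _, h2⟩
      · simpa using h1 j
    · intro h
      refine ⟨fun j => ?_, ?_⟩
      · have hj := h j
        split_ifs at hj with hj'
        · exact ((answers_append ..).1 hj).1
        · simpa using hj
      · have hj := h m.1.2
        rw [if_pos rfl] at hj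
        exact ((answers_append ..).1 hj).2

lemma outcome_conComp {k : ℕ} (M : Fin k → InteractiveMechanism D Q A) (x : D)
    (H : List ((Q × Fin k) × A)) (o : Option (Q × Fin k)) (r : (conComp M).Coins) :
    Outcome (conComp M) x H o r ↔
      ∀ j, Outcome (M j) x (subhistory j H) ((o.filter fun m => m.2 = j).map Prod.fst) (r j) := by
  unfold Outcome
  rw [forall_and, ← answers_conComp]
  refine and_congr_right fun _ => ?_
  cases o with
  | none => simp
  | some m =>
    simp only [Option.mem_some_iff, forall_eq', conComp_respond]
    constructor
    · intro h j q hq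
      by_cases hj : m.2 = j
      · subst hj
        obtain rfl : m.1 = q := by simpa [Option.filter] using hq
        exact h
      · simp [Option.filter, hj] at hq
    · intro h
      exact h m.2 m.1 (by simp [Option.filter])

/-- The mechanism `M` with its input given by `f`. -/
def InteractiveMechanism.comap (M : InteractiveMechanism D Q A) (f : E → D) :
    InteractiveMechanism E Q A where
  Coins := M.Coins
  coinLaw := M.coinLaw
  respond x := M.respond (f x)
  measurableSet_respond x := M.measurableSet_respond (f x)

lemma view_congr (𝒜 : Adversary Q A) (M : InteractiveMechanism D Q A)
    (N : InteractiveMechanism E Q A) (x : D) (y : E) (rA : 𝒜.Coins) (rM : M.Coins) (rN : N.Coins)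
    (h : ∀ l, M.respond x l rM = N.respond y l rN) : view 𝒜 M x rA rM = view 𝒜 N y rA rN := by
  have ht : ∀ n, transcript 𝒜 M x rA rM n = transcript 𝒜 N y rA rN n := by
    intro n
    induction n with
    | zero => rfl
    | succ n ih => simp only [transcript, ih, h]
  simp only [view, ht]

/-- The law of the answers that `𝒜` with coins `rA` receives from `M`. -/
def answerLaw (𝒜 : Adversary Q A) (M : InteractiveMechanism D Q A) (x : D) (rA : 𝒜.Coins) :
    Measure (ℕ → Option A) :=
  M.coinLaw.map fun rM => (view 𝒜 M x rA rM).2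

lemma answerLaw_apply [Countable Q] [Countable A] (𝒜 : Adversary Q A)
    (M : InteractiveMechanism D Q A) (x : D) (rA : 𝒜.Coins) {S : Set (ℕ → Option A)}
    (hS : MeasurableSet S) :
    answerLaw 𝒜 M x rA S = M.coinLaw {rM | (view 𝒜 M x rA rM).2 ∈ S} :=
  Measure.map_apply (measurable_view_snd 𝒜 M x rA) hS

instance [Countable Q] [Countable A] (𝒜 : Adversary Q A) (M : InteractiveMechanism D Q A) (x : D)
    (rA : 𝒜.Coins) : IsProbabilityMeasure (answerLaw 𝒜 M x rA) :=
  Measure.isProbabilityMeasure_map (measurable_view_snd 𝒜 M x rA).aemeasurable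

/-- Concurrent composition is at least as private as composed randomized response: running each
`M j` on one of the two datasets, chosen by the bit `c j`, gives laws that factorize as
`measureReal_le_hockeyStick` requires. -/
theorem conComp_isDP_of_hockeyStick_le [Countable Q] [Countable A] {k : ℕ} {adj : D → D → Prop}
    (hadj : ∀ x x', adj x x' → adj x' x) (M : Fin k → InteractiveMechanism D Q A) (ε : Fin k → ℝ)
    (hε : ∀ j, 0 ≤ ε j) (hM : ∀ j, (M j).IsDP adj (ε j) 0) {g δ : ℝ}
    (hg : hockeyStick ε g ≤ δ) (hδ : 0 ≤ δ) : (conComp M).IsDP adj g δ := by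
  intro x x' hx 𝒜 T hT
  refine probView_le_of_forall_coins 𝒜 _ x x' g δ (fun rA S hS => ?_) hT
  let N : Fin k → InteractiveMechanism (Fin k → Bool) Q A :=
    fun j => (M j).comap fun c => if c j then x else x'
  have hlaw : ∀ y c, (∀ j, (if c j then x else x') = y) →
      (conComp M).coinLaw {rM | (view 𝒜 (conComp M) y rA rM).2 ∈ S} =
        answerLaw 𝒜 (conComp N) c rA S := by
    intro y c hc
    rw [answerLaw_apply _ _ _ _ hS]
    refine congrArg (conComp M).coinLaw (Set.ext fun rM => ?_)
    have hv : view 𝒜 (conComp M) y rA rM = view 𝒜 (conComp N) c rA rM :=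
      view_congr _ _ _ _ _ _ _ _ fun l => by
        simp only [conComp, N, InteractiveMechanism.comap, hc]
    change (view 𝒜 (conComp M) y rA rM).2 ∈ S ↔ (view 𝒜 (conComp N) c rA rM).2 ∈ S
    rw [hv]
  rw [hlaw x (fun _ => true) (by simp), hlaw x' (fun _ => false) (by simp),
    measure_le_iff_real _ _ _ _ g hδ]
  refine (measureReal_le_hockeyStick ε hε (fun c => answerLaw 𝒜 (conComp N) c rA)
    (fun n a => ?_) g hS).trans (by gcongr)
  have hcyl : MeasurableSet {f : ℕ → Option A | ∀ i < n, f i = a i} := by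
    simp only [Set.ofPred_forall]
    exact MeasurableSet.iInter fun i => MeasurableSet.iInter fun _ =>
      measurable_pi_apply (X := fun _ : ℕ => Option A) i
        (MeasurableSet.of_discrete (s := {a i}))
  rcases view_prefix_iff_outcome 𝒜 (conComp N) rA n a with h | ⟨H, o, h⟩
  · refine ⟨0, fun _ _ => 0, le_rfl, by simp, by simp, fun c => ?_⟩
    rw [measureReal_def, answerLaw_apply _ _ _ _ hcyl]
    simp [h]
  · let o' (j : Fin k) : Option Q := (o.filter fun m => m.2 = j).map Prod.fst
    refine ⟨1, fun j c => (M j).coinLaw.real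
      {r | Outcome (M j) (if c then x else x') (subhistory j H) (o' j) r}, zero_le_one,
      fun j c => measureReal_nonneg, fun j c => ?_, fun c => ?_⟩
    · cases c
      · simpa using (hM j).outcome_le (hadj _ _ hx) (subhistory j H) (o' j)
      · simpa using (hM j).outcome_le hx (subhistory j H) (o' j)
    · rw [measureReal_def, answerLaw_apply _ _ _ _ hcyl, one_mul]
      have hset : {rM | (view 𝒜 (conComp N) c rA rM).2 ∈ {f | ∀ i < n, f i = a i}} =
          Set.univ.pi fun j => {r : (M j).Coins |
            Outcome (M j) (if c j then x else x') (subhistory j H) (o' j) r} := by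
        exact Set.ext fun r =>
          (h c r).trans ((outcome_conComp N c H o r).trans Set.mem_univ_pi.symm)
      rw [hset]
      change ((Measure.pi fun j => (M j).coinLaw) _).toReal = _
      rw [Measure.pi_pi, ENNReal.toReal_prod]
      rfl

lemma DatasetAdj.symm {X : Type*} (x x' : Multiset X) (h : DatasetAdj x x') : DatasetAdj x' x :=
  h.imp fun _ => Or.symm

/-! ### Randomized response as an interactive mechanism -/

open Classical in
/-- The interactive mechanism that answers every query by the same randomized response to the bit
that tells whether the dataset is empty, the bit `true` being encoded by the answer `a₁` and `false`
by `a₀`. Its coin is `true` iff the response is truthful. -/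
def rrMechanism (X Q : Type*) {A : Type*} (ε : ℝ) (a₀ a₁ : A) :
    InteractiveMechanism (Multiset X) Q A where
  Coins := Bool
  coinLaw := RR ε true
  respond x _ r := some (if r = decide (x = 0) then a₁ else a₀)
  measurableSet_respond _ _ _ := MeasurableSet.of_discrete

lemma RR_le (ε : ℝ) (hε : 0 ≤ ε) (c c' : Bool) (S : Set Bool) :
    RR ε c S ≤ ENNReal.ofReal (Real.exp ε) * RR ε c' S := by
  classical
  have h := (measure_le_iff_real (RR ε c) (RR ε c') S S ε le_rfl).2
  rw [ENNReal.ofReal_zero, add_zero, add_zero] at h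
  apply h
  rw [← Set.coe_toFinset S, ← sum_measureReal_singleton, ← sum_measureReal_singleton,
    Finset.mul_sum]
  refine Finset.sum_le_sum fun b _ => ?_
  rw [RR_real_singleton, RR_real_singleton]
  exact rrWeight_le ε hε c c' b

/-- `RR ε c` is the law of the response to `c` when the coin `r` tells whether it is truthful. -/
lemma map_RR_true (ε : ℝ) (c : Bool) :
    (RR ε true).map (fun r => decide (r = c)) = RR ε c := by
  have h : Measurable fun r : Bool => decide (r = c) := measurable_of_finite _
  simp only [RR, Measure.map_add _ _ h, Measure.map_smul, Measure.map_dirac' h]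
  cases c <;> simp

lemma rrMechanism_isDP (X : Type*) {Q A : Type*} [Countable Q] [Countable A] (ε : ℝ) (hε : 0 ≤ ε)
    (a₀ a₁ : A) (adj : Multiset X → Multiset X → Prop) :
    (rrMechanism X Q ε a₀ a₁).IsDP adj ε 0 := by
  classical
  intro x x' _ 𝒜 T hT
  refine probView_le_of_forall_coins 𝒜 _ x x' ε 0 (fun rA S _ => ?_) hT
  -- The answers are a function of the response bit alone.
  have key : ∀ y : Multiset X, (rrMechanism X Q ε a₀ a₁).coinLaw
      {r | (view 𝒜 (rrMechanism X Q ε a₀ a₁) y rA r).2 ∈ S} =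
      RR ε (decide (y = 0)) {b | (view 𝒜 (rrMechanism X Q ε a₀ a₁) 0 rA b).2 ∈ S} := by
    intro y
    rw [← map_RR_true ε (decide (y = 0)),
      Measure.map_apply (measurable_of_finite _) MeasurableSet.of_discrete]
    refine congrArg (RR ε true) (Set.ext fun (r : Bool) => ?_)
    have hv : view 𝒜 (rrMechanism X Q ε a₀ a₁) y rA r =
        view 𝒜 (rrMechanism X Q ε a₀ a₁) 0 rA (decide (r = decide (y = 0))) :=
      view_congr _ _ _ _ _ _ _ _ fun l => by simp [rrMechanism]
    change (view 𝒜 (rrMechanism X Q ε a₀ a₁) y rA r).2 ∈ S ↔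
      (view 𝒜 (rrMechanism X Q ε a₀ a₁) 0 rA (decide (r = decide (y = 0)))).2 ∈ S
    rw [hv]
  rw [key, key, ENNReal.ofReal_zero, add_zero]
  exact RR_le ε hε _ _ _

/-- An adversary that asks every mechanism once learns the output of composed randomized
response. -/
theorem isDP_comp_RR_of_conComp_rrMechanism {X Q A : Type*} [Countable Q] [Countable A]
    [Nonempty X] [Nonempty Q] {a₀ a₁ : A} (ha : a₀ ≠ a₁) {k : ℕ} (ε : Fin k → ℝ) {g δ : ℝ}
    (h : (conComp fun i => rrMechanism X Q (ε i) a₀ a₁).IsDP DatasetAdj g δ) :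
    IsDP BitAdj (comp fun i => RR (ε i)) g δ := by
  classical
  intro b b' hb T hT
  obtain ⟨p⟩ := ‹Nonempty X›
  obtain ⟨q⟩ := ‹Nonempty Q›
  let ds (b : Bool) : Multiset X := if b then 0 else {p}
  have hds0 : ∀ b, decide (ds b = 0) = b := by
    intro b; cases b <;> simp [ds]
  have hds : DatasetAdj (ds b) (ds b') := by
    refine ⟨p, ?_⟩
    revert hb
    cases b <;> cases b' <;> simp [BitAdj, ds]
  set M := conComp fun i => rrMechanism X Q (ε i) a₀ a₁ with hMdef
  let qs : List (Q × Fin k) := (List.finRange k).map fun i => (q, i)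
  let S : Set (ℕ → Option A) := (fun f i => decide (f (i : Fin k) = some a₁)) ⁻¹' T
  have hS : MeasurableSet S := by
    refine (measurable_pi_lambda _ fun i => ?_) hT
    exact (measurable_of_countable (fun y : Option A => decide (y = some a₁))).comp
      (measurable_pi_apply _)
  have key : ∀ c, M.coinLaw {r | (view (scriptedAdversary A qs) M (ds c) () r).2 ∈ S} =
      comp (fun i => RR (ε i)) c T := by
    intro c
    have hmap : comp (fun i => RR (ε i)) c =
        (Measure.pi fun i => RR (ε i) true).map fun r i => decide (r i = c) := by
      rw [Measure.pi_map_pi (f := fun _ b => decide (b = c))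
        fun i => (measurable_of_finite _).aemeasurable]
      simp only [map_RR_true, comp]
    rw [hmap, Measure.map_apply (measurable_of_finite _) hT]
    refine congrArg (Measure.pi fun i => RR (ε i) true) (Set.ext fun (r : Fin k → Bool) => ?_)
    change ((fun i : Fin k => decide
      ((view (scriptedAdversary A qs) M (ds c) () r).2 i = some a₁)) ∈ T) ↔
        (fun i => decide (r i = c)) ∈ T
    have hresp : ∀ l i, M.respond (ds c) (l ++ [(q, i)]) r =
        some (if r i = c then a₁ else a₀) := by
      intro l i
      change ((l ++ [(q, i)]).getLast?.bind fun m =>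
        some (if r m.2 = decide (ds c = 0) then a₁ else a₀)) = _
      simp [hds0]
    let H : List ((Q × Fin k) × A) :=
      (List.finRange k).map fun i => ((q, i), if r i = c then a₁ else a₀)
    have hH : H.map Prod.fst = qs := by simp [H, qs, Function.comp_def]
    have hans : Answers M (ds c) H r := by
      intro h' m hm
      have hmem : m ∈ H := hm.subset (by simp)
      obtain ⟨i, -, rfl⟩ := List.mem_map.1 hmem
      exact hresp _ i
    have hview := (view_snd_eq_iff_answers (scriptedAdversary A qs) M (ds c) () r H
      (asks_scriptedAdversary _ _ (by rw [hH]) _)).2 hans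
    have : (fun i : Fin k => decide
        ((view (scriptedAdversary A qs) M (ds c) () r).2 i = some a₁)) =
        fun i => decide (r i = c) := by
      funext i
      rw [hview i (by simp [H])]
      by_cases hr : r i = c <;> simp [H, hr, ha]
    rw [this]
  have := h _ _ hds (scriptedAdversary A qs) _ (measurable_snd hS)
  rwa [probView_scriptedAdversary _ _ _ hS, probView_scriptedAdversary _ _ _ hS, key, key] at this

end

end ConcurrentDP

theorem corollary9 :
    -- for all pure DP mechanisms: `ConComp(M)` is at least as private as `Comp(RR)`
    (∀ (X : Type u) (Q : Type v) (A : Type w) [Countable Q] [Countable A] (k : ℕ)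
      (ε : Fin k → ℝ) (M : Fin k → InteractiveMechanism (Multiset X) Q A) (δg : ℝ),
      (∀ i, 0 ≤ ε i) → (∀ i, (M i).IsDP DatasetAdj (ε i) 0) → 0 ≤ δg →
        (∀ εg : ℝ, 0 ≤ εg → IsDP BitAdj (comp fun i => RR (ε i)) εg δg →
          (conComp M).IsDP DatasetAdj εg δg) ∧
        (conComp M).privLoss DatasetAdj δg ≤ privLoss BitAdj (comp fun i => RR (ε i)) δg) ∧
    -- the worst-case privacy loss equals that of `Comp(RR)`
    (∀ (X : Type u) (Q : Type v) (A : Type w) [Countable Q] [Countable A]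
      [Nonempty X] [Nonempty Q] [Nontrivial A] (k : ℕ) (ε : Fin k → ℝ) (δg : ℝ),
      (∀ i, 0 ≤ ε i) → 0 ≤ δg →
        IsGreatest {p : ENNReal | ∃ M : Fin k → InteractiveMechanism (Multiset X) Q A,
            (∀ i, (M i).IsDP DatasetAdj (ε i) 0) ∧ p = (conComp M).privLoss DatasetAdj δg}
          (privLoss BitAdj (comp fun i => RR (ε i)) δg)) ∧
    -- optimal composition
    (∀ (k : ℕ) (ε : Fin k → ℝ) (δg : ℝ), (∀ i, 0 ≤ ε i) → 0 ≤ δg →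
      ∃ εg : ℝ,
        IsLeast {e : ℝ | 0 ≤ e ∧
          1 / (∏ i, (1 + Real.exp (ε i))) *
            ∑ S : Finset (Fin k),
              max (Real.exp (∑ i ∈ S, ε i) - Real.exp e * Real.exp (∑ i ∈ Sᶜ, ε i)) 0 ≤ δg} εg ∧
        privLoss BitAdj (comp fun i => RR (ε i)) δg = ENNReal.ofReal εg ∧
        ∀ (X : Type u) (Q : Type v) (A : Type w) [Countable Q] [Countable A]
          (M : Fin k → InteractiveMechanism (Multiset X) Q A),
          (∀ i, (M i).IsDP DatasetAdj (ε i) 0) → (conComp M).IsDP DatasetAdj εg δg) ∧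
    -- optimal composition, homogeneous case
    (∀ (k : ℕ) (ε : ℝ) (δg : ℝ), 0 ≤ ε → 0 ≤ δg →
      ∃ εg : ℝ,
        IsLeast {e : ℝ | 0 ≤ e ∧
          1 / (1 + Real.exp ε) ^ k *
            ∑ i ∈ Finset.range (k + 1), (k.choose i : ℝ) *
              max (Real.exp ((i : ℝ) * ε) - Real.exp e * Real.exp (((k : ℝ) - i) * ε)) 0
            ≤ δg} εg ∧
        privLoss BitAdj (comp fun _ : Fin k => RR ε) δg = ENNReal.ofReal εg ∧
        ∀ (X : Type u) (Q : Type v) (A : Type w) [Countable Q] [Countable A]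
          (M : Fin k → InteractiveMechanism (Multiset X) Q A),
          (∀ i, (M i).IsDP DatasetAdj ε 0) → (conComp M).IsDP DatasetAdj εg δg) ∧
    -- advanced composition, with a universal constant
    (∃ C : ℝ, 0 < C ∧
      ∀ (X : Type u) (Q : Type v) (A : Type w) [Countable Q] [Countable A] (k : ℕ)
        (ε δ' : ℝ) (M : Fin k → InteractiveMechanism (Multiset X) Q A),
        0 ≤ ε → (k : ℝ) * ε ^ 2 < 1 → 0 < δ' → δ' < 1 / 2 →
        (∀ i, (M i).IsDP DatasetAdj ε 0) →
          (conComp M).IsDP DatasetAdj (C * √(k * Real.log (1 / δ')) * ε) δ') := by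
  refine ⟨?_, ?_, ?_, ?_, 3, by norm_num, ?_⟩
  · intro X Q A _ _ k ε M δg hε hM hδ
    have h : ∀ εg : ℝ, IsDP BitAdj (comp fun i => RR (ε i)) εg δg →
        (conComp M).IsDP DatasetAdj εg δg := fun εg h =>
      conComp_isDP_of_hockeyStick_le DatasetAdj.symm M ε hε hM ((isDP_comp_RR_iff ε εg hδ).1 h) hδ
    exact ⟨fun εg _ => h εg, le_iInf₂ fun e he => iInf₂_le e (h e he)⟩
  · intro X Q A _ _ _ _ _ k ε δg hε hδ
    have h : ∀ M : Fin k → InteractiveMechanism (Multiset X) Q A,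
        (∀ i, (M i).IsDP DatasetAdj (ε i) 0) →
        (conComp M).privLoss DatasetAdj δg ≤ privLoss BitAdj (comp fun i => RR (ε i)) δg :=
      fun M hM => le_iInf₂ fun e he => iInf₂_le e
        (conComp_isDP_of_hockeyStick_le DatasetAdj.symm M ε hε hM
          ((isDP_comp_RR_iff ε e hδ).1 he) hδ)
    constructor
    · obtain ⟨a₀, a₁, ha⟩ := exists_pair_ne A
      have hM : ∀ i, (rrMechanism X Q (ε i) a₀ a₁).IsDP DatasetAdj (ε i) 0 :=
        fun i => rrMechanism_isDP X (ε i) (hε i) a₀ a₁ DatasetAdj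
      exact ⟨fun i => rrMechanism X Q (ε i) a₀ a₁, hM, le_antisymm
        (le_iInf₂ fun e he => iInf₂_le e (isDP_comp_RR_of_conComp_rrMechanism ha ε he)) (h _ hM)⟩
    · rintro p ⟨M, hM, rfl⟩
      exact h M hM
  · intro k ε δg hε hδ
    obtain ⟨g, hg, hloss⟩ := exists_isLeast_hockeyStick ε hε hδ
    exact ⟨g, hg, hloss, fun X Q A _ _ M hM =>
      conComp_isDP_of_hockeyStick_le DatasetAdj.symm M ε hε hM hg.1.2 hδ⟩
  · intro k ε δg hε hδ
    obtain ⟨g, hg, hloss⟩ := exists_isLeast_hockeyStick (fun _ : Fin k => ε) (fun _ => hε) hδ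
    refine ⟨g, ?_, hloss, fun X Q A _ _ M hM =>
      conComp_isDP_of_hockeyStick_le DatasetAdj.symm M _ (fun _ => hε) hM hg.1.2 hδ⟩
    simpa only [hockeyStick_const] using hg
  · intro X Q A _ _ k ε δ M hε hk hδ hδ' hM
    exact conComp_isDP_of_hockeyStick_le DatasetAdj.symm M _ (fun _ => hε) hM
      (hockeyStick_advanced k ε δ hε hk hδ hδ') hδ.le
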